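/- **Setting.** Let $d,m\ge 1$, let $\Omega\subset\mathbb R^d$ be a bounded open set, and let $\mathbb R^{m\times d}$ carry the Frobenius inner product $(A,B)=\operatorname{Tr}(AB^T)$ and norm $|A|$. Let $\psi_n$ be a bounded sequence in $W^{1,2}(\Omega;\mathbb R^m)$ and let $\alpha_n>0$ be numbers such that $\alpha_n\psi_n$ is bounded in $W^{1,\infty}(\Omega;\mathbb R^m)$. Let $R\ge 0$ satisfy $\|\alpha_n\nabla\psi_n\|_{L^\infty(\Omega)}\le R$ for all $n$ (for example $R=\sup_n\|\alpha_n\nabla\psi_n\|_\infty$). For $f_n\in L^1(\Omega)$, a finite Borel measure $\pi$ on $\overline\Omega$ and $g\in L^1(\overline\Omega,\pi)$, write $f_n\overset{*}{\rightharpoonup} g\,d\pi$ if $\int_\Omega \xi f_n\,dx\to\int_{\overline\Omega}\xi g\,d\pi$ for every $\xi\in C(\overline\Omega)$. **Theorem (representation formula).** There are a subsequence (not relabeled), a nonnegative finite Radon measure $\pi$ on $\overline\Omega$, and Borel measurable families of probability measures $\{\mu_x\}_{x\in\overline\Omega}$ supported on the ball $\overline{\mathcal B}(0,R)=\{|A|\le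 R\}$ and $\{\lambda_x\}_{x\in\overline\Omega}$ supported on the unit sphere $\mathcal S=\{|A|=1\}$ of $\mathbb R^{m\times d}$, such that the following hold for this one choice of subsequence, $\pi$, $\mu$ and $\lambda$. In each formula all functions are integrable as the definition of $\overset{*}{\rightharpoonup}$ requires. 1. Let $y\in C^1(\overline\Omega;\mathbb R^m)$ and $F(x)=\nabla y(x)$, and let $W:\overline\Omega\times\mathbb R^{m\times d}\to\mathbb R$ be continuous and of class $C^2$ on the range of $F$; that is, there is an open set $\mathcal O\supset F(\overline\Omega)$ such that $W_F$ and $W_{FF}$ exist and are continuous on $\overline\Omega\times\mathcal O$. Put $$W^\circ(x,A)=W(x,F(x)+A)-W(x,F(x))-(W_F(x,F(x)),A),\qquad \mathsf L(x)=W_{FF}(x,F(x)),$$ $$U(x,A)=\frac{W^\circ(x,A)-\frac12(\mathsf L(x)A,A)}{|A|^2}\ (A\ne0),\quad U(x,0)=0,\qquad \mathcal F(x,\alpha,G)=\frac{W^\circ(x,\alpha G)}{\alpha^2}=U(x,\alpha G)|G|^2+\tfrac12(\mathsf L(x)G,G).$$ Then $$\mathcal F(x,\alpha_n,\nabla\psi_n)\overset{*}{\rightharpoonup}\left[\int_{\overline{\mathcal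 B}(0,R)}U(x,A)\,d\mu_x(A)+\frac12\int_{\mathcal S}(\mathsf L(x)A,A)\,d\lambda_x(A)\right]d\pi .$$ 2. More generally, for every continuous $U:\overline\Omega\times\mathbb R^{m\times d}\to\mathbb R$ and every continuous fourth order tensor field $\mathsf L$ on $\overline\Omega$, $$U(x,\alpha_n\nabla\psi_n)|\nabla\psi_n|^2+\tfrac12(\mathsf L(x)\nabla\psi_n,\nabla\psi_n)\overset{*}{\rightharpoonup}\left[\int_{\overline{\mathcal B}(0,R)}U(x,A)\,d\mu_x(A)+\frac12\int_{\mathcal S}(\mathsf L(x)A,A)\,d\lambda_x(A)\right]d\pi .$$ 3. In particular, $|\nabla\psi_n|^2\overset{*}{\rightharpoonup}d\pi$. -/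

import Mathlib

open MeasureTheory ProbabilityTheory Filter Topology
open scoped ENNReal NNReal

noncomputable section

namespace StrongLocalMin

/-- The Euclidean space `ℝᵏ`. -/
abbrev Vec (k : ℕ) : Type := EuclideanSpace ℝ (Fin k)

/-- The space of real `m × d` matrices.  Its Euclidean norm is the Frobenius norm. -/
abbrev Mat (m d : ℕ) : Type := EuclideanSpace ℝ (Fin m × Fin d)

/-- Fourth order tensors, as bilinear forms: `L A B` is the number `(L A, B)`. -/
abbrev Tensor4 (m d : ℕ) : Type := Mat m d →L[ℝ] Mat m d →L[ℝ] ℝ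

variable {d m : ℕ}

/-! ### Sobolev functions -/

/-- `Du` is the weak gradient of `u` on the open set `Ω`: both are locally integrable and
`∫_Ω uᵢ ∂ⱼφ = - ∫_Ω (Du)ᵢⱼ φ` for all test functions `φ ∈ C_c^∞(Ω)`. -/
structure HasWeakGradient (Ω : Set (Vec d)) (u : Vec d → Vec m) (Du : Vec d → Mat m d) :
    Prop where
  locallyIntegrableOn : LocallyIntegrableOn u Ω
  locallyIntegrableOn_grad : LocallyIntegrableOn Du Ω
  integral_eq : ∀ φ : Vec d → ℝ, ContDiff ℝ ((⊤ : ℕ∞) : WithTop ℕ∞) φ → HasCompactSupport φ →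
    tsupport φ ⊆ Ω → ∀ (i : Fin m) (j : Fin d),
      ∫ x in Ω, u x i * fderiv ℝ φ x (EuclideanSpace.single j 1)
        = - ∫ x in Ω, Du x (i, j) * φ x

/-- `u ∈ W^{1,p}(Ω; ℝᵐ)` with weak gradient `Du`. -/
structure MemW1 (Ω : Set (Vec d)) (p : ℝ≥0∞) (u : Vec d → Vec m) (Du : Vec d → Mat m d) :
    Prop where
  memLp : MemLp u p (volume.restrict Ω)
  memLp_grad : MemLp Du p (volume.restrict Ω)
  hasWeakGradient : HasWeakGradient Ω u Du

/-- `u n` is a bounded sequence in `W^{1,p}(Ω; ℝᵐ)`, with weak gradients `Du n`. -/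
def BoundedInW1 (Ω : Set (Vec d)) (p : ℝ≥0∞) (u : ℕ → Vec d → Vec m)
    (Du : ℕ → Vec d → Mat m d) : Prop :=
  ∃ C : ℝ≥0, ∀ n, MemW1 Ω p (u n) (Du n) ∧
    eLpNorm (u n) p (volume.restrict Ω) ≤ C ∧ eLpNorm (Du n) p (volume.restrict Ω) ≤ C

/-! ### The Lagrangian and the reduced Lagrangian -/

/-- The Jacobian matrix `(∂ⱼ yᵢ)` of `y` at `x`. -/
def jacobian (y : Vec d → Vec m) (x : Vec d) : Mat m d :=
  WithLp.toLp 2 fun p => fderiv ℝ y x (EuclideanSpace.single p.2 1) p.1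

/-- `y ∈ C¹(Ω̄; ℝᵐ)`, and `F : Ω̄ → ℝ^{m×d}` is its gradient, continuous up to the boundary. -/
structure IsC1UpToBoundary (Ω : Set (Vec d)) (y : Vec d → Vec m) (F : Vec d → Mat m d) :
    Prop where
  continuousOn : ContinuousOn y (closure Ω)
  continuousOn_grad : ContinuousOn F (closure Ω)
  differentiableAt : ∀ x ∈ Ω, DifferentiableAt ℝ y x
  grad_eq : ∀ x ∈ Ω, F x = jacobian y x

/-- Assumptions on the Lagrangian: `W` is continuous on `Ω̄ × ℝ^{m×d}`, and it is of class `C²`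
on the range of `F = ∇y`, i.e. there is an open set `O` that contains `F x` for all `x ∈ Ω̄` and
such that `W_F` and `W_FF` exist and are continuous on `Ω̄ × O`. -/
structure IsLagrangian (Ω : Set (Vec d)) (W : Vec d → Mat m d → ℝ) (F : Vec d → Mat m d) :
    Prop where
  continuousOn : ContinuousOn (fun q : Vec d × Mat m d => W q.1 q.2) (closure Ω ×ˢ Set.univ)
  smooth : ∃ O : Set (Mat m d), IsOpen O ∧ (∀ x ∈ closure Ω, F x ∈ O) ∧
    (∀ x ∈ closure Ω, ∀ A ∈ O,
      DifferentiableAt ℝ (W x) A ∧ DifferentiableAt ℝ (fderiv ℝ (W x)) A) ∧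
    ContinuousOn (fun q : Vec d × Mat m d => fderiv ℝ (W q.1) q.2) (closure Ω ×ˢ O) ∧
    ContinuousOn (fun q : Vec d × Mat m d => fderiv ℝ (fderiv ℝ (W q.1)) q.2) (closure Ω ×ˢ O)

/-- The reduced Lagrangian
`W°(x, A) = W(x, F(x) + A) - W(x, F(x)) - (W_F(x, F(x)), A)`. -/
def Wcirc (W : Vec d → Mat m d → ℝ) (F : Vec d → Mat m d) (x : Vec d) (A : Mat m d) : ℝ :=
  W x (F x + A) - W x (F x) - fderiv ℝ (W x) (F x) A

/-- The Hessian `L(x) = W_FF(x, F(x))`. -/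
def hessL (W : Vec d → Mat m d → ℝ) (F : Vec d → Mat m d) (x : Vec d) : Tensor4 m d :=
  fderiv ℝ (fderiv ℝ (W x)) (F x)

/-- `U(x, A) = (W°(x, A) - (L(x) A, A) / 2) / |A|²`, extended by `U(x, 0) = 0`
(the convention `0 / 0 = 0` gives this value). -/
def remU (W : Vec d → Mat m d → ℝ) (F : Vec d → Mat m d) (x : Vec d) (A : Mat m d) : ℝ :=
  (Wcirc W F x A - 1 / 2 * hessL W F x A A) / ‖A‖ ^ 2

/-- `𝓕(x, α, G) = W°(x, α G) / α²`. -/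
def calF (W : Vec d → Mat m d → ℝ) (F : Vec d → Mat m d) (x : Vec d) (α : ℝ) (G : Mat m d) : ℝ :=
  Wcirc W F x (α • G) / α ^ 2

/-! ### The limit -/

/-- `𝓘(x, μ_x, λ_x) = ∫_{|A| ≤ R} U(x, A) dμ_x(A) + ½ ∫_{|A| = 1} (L(x) A, A) dλ_x(A)`. -/
def calI (R : ℝ) (U : Vec d → Mat m d → ℝ) (L : Vec d → Tensor4 m d)
    (μ lam : Kernel (Vec d) (Mat m d)) (x : Vec d) : ℝ :=
  (∫ A in Metric.closedBall 0 R, U x A ∂(μ x))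
    + 1 / 2 * ∫ A in Metric.sphere 0 1, L x A A ∂(lam x)

/-- Weak-* convergence `f n dx ⇀* g dπ` of (signed) measures on the compact set `Ω̄`, where
`f n ∈ L¹(Ω)` and `g ∈ L¹(Ω̄, π)`, tested with all `ξ ∈ C(Ω̄)`. -/
structure WeakStarTendsto (Ω : Set (Vec d)) (f : ℕ → Vec d → ℝ) (g : Vec d → ℝ)
    (π : Measure (Vec d)) : Prop where
  integrableOn : ∀ n, IntegrableOn (f n) Ω
  integrableOn_limit : IntegrableOn g (closure Ω) π
  tendsto : ∀ ξ : Vec d → ℝ, ContinuousOn ξ (closure Ω) →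
    Tendsto (fun n => ∫ x in Ω, ξ x * f n x) atTop (𝓝 (∫ x in closure Ω, ξ x * g x ∂π))

end StrongLocalMin

end

/-! Push the energy `|∇ψ_n|² dx` forward under `x ↦ (x, α_n∇ψ_n, ∇ψ_n/|∇ψ_n|)`. The resulting
measures live on the compact set `Ω̄ × B̄(0,R) × S`, and their masses are bounded by the `L²` bound
on the gradients, so a subsequence converges weakly-* to a finite measure `ρ`
(`exists_subseq_tendsto_integral`).

By homogeneity, `U(x,αG)|G|² + ½(L G,G)` is `|G|²` times one continuous function of `(x, αG, G/|G|)`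
(`energy_integrand_eq`). Integrals of the nonlinear expression are thus linear in the energy
measure, and one subsequence serves all `U`, `L` and test functions.

The limit integrand is a function of `(x,A)` plus a function of `(x,B)`, so only two marginals of
`ρ` matter. Disintegrating them over the common first marginal `π` gives `μ_x` and `λ_x`
(`exists_kernels`).

A Lagrangian reduces to such a pair because its remainder `U` is continuous up to `A = 0`, by a
Taylor estimate locally uniform in `x` (`continuousOn_remU`). -/

namespace StrongLocalMin

/-! ### Weak-* compactness of bounded measures on a compact set. -/

section Extraction

/-- A continuous function on a compact set agrees there with a bounded continuous function on the
whole space. -/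
theorem exists_boundedContinuousFunction_eqOn {E : Type*} [TopologicalSpace E] [T4Space E]
    {K : Set E}
    (hK : IsCompact K) {f : E → ℝ} (hf : ContinuousOn f K) :
    ∃ g : BoundedContinuousFunction E ℝ, Set.EqOn g f K := by
  have : CompactSpace K := isCompact_iff_compactSpace.1 hK
  obtain ⟨g, -, hg⟩ := BoundedContinuousFunction.exists_extension_norm_eq_of_isClosedEmbedding
    (BoundedContinuousFunction.mkOfCompact ⟨K.domRestrict f, hf.domRestrict⟩)
    hK.isClosed.isClosedEmbedding_subtypeVal
  exact ⟨g, fun x hx => congrFun hg ⟨x, hx⟩⟩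

variable {E : Type*} [MeasurableSpace E]

theorem restrict_eq_self_of_compl_null {ν : Measure E} {K : Set E} (h : ν Kᶜ = 0) :
    ν.restrict K = ν :=
  Measure.restrict_eq_self_of_ae_mem (mem_ae_iff.2 h)

/-- A finite measure on a nonempty measurable set is its mass times a probability measure on this
set. -/
theorem exists_probabilityMeasure_smul_eq (ν : Measure E) [IsFiniteMeasure ν] {K : Set E}
    (hK : MeasurableSet K) (hne : K.Nonempty) (h : ν Kᶜ = 0) :
    ∃ p : ProbabilityMeasure E, (p : Measure E) Kᶜ = 0 ∧ ν = ν Set.univ • (p : Measure E) := by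
  -- The zero measure cannot be normalized; a Dirac mass at a point of `K` stands in for it.
  by_cases h0 : ν = 0
  · obtain ⟨k, hk⟩ := hne
    refine ⟨⟨Measure.dirac k, inferInstance⟩, ?_, by simp [h0]⟩
    simp [Measure.dirac_apply' _ hK.compl, hk]
  · have hν : ν Set.univ ≠ 0 := by simpa using h0
    have : NeZero ν := ⟨h0⟩
    refine ⟨⟨(ν Set.univ)⁻¹ • ν, isProbabilityMeasureSMul⟩, by simp [h], ?_⟩
    simp only [ProbabilityMeasure.coe_mk, smul_smul]
    rw [ENNReal.mul_inv_cancel hν (measure_ne_top _ _), one_smul]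

variable [TopologicalSpace E] [BorelSpace E]

theorem integrable_of_continuousOn_of_compl_null [T2Space E] {ν : Measure E} [IsFiniteMeasure ν]
    {K : Set E} (hK : IsCompact K) (h : ν Kᶜ = 0) {f : E → ℝ} (hf : ContinuousOn f K) :
    Integrable f ν := by
  simpa [IntegrableOn, restrict_eq_self_of_compl_null h] using
    hf.integrableOn_compact (μ := ν) hK

/-- Sequential compactness of bounded sets of measures on a compact set. -/
theorem exists_subseq_tendsto_integral [TopologicalSpace.MetrizableSpace E]
    [TopologicalSpace.SeparableSpace E] {K : Set E} (hK : IsCompact K)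
    (ν : ℕ → Measure E) [∀ n, IsFiniteMeasure (ν n)] (hνK : ∀ n, ν n Kᶜ = 0) {C : ℝ≥0}
    (hνC : ∀ n, ν n Set.univ ≤ C) :
    ∃ (s : ℕ → ℕ) (ρ : Measure E), StrictMono s ∧ IsFiniteMeasure ρ ∧ ρ Kᶜ = 0 ∧
      ∀ f : E → ℝ, ContinuousOn f K →
        Tendsto (fun n => ∫ x, f x ∂(ν (s n))) atTop (𝓝 (∫ x, f x ∂ρ)) := by
  rcases K.eq_empty_or_nonempty with rfl | hne
  · have h0 : ∀ n, ν n = 0 := fun n => by simpa using hνK n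
    exact ⟨id, 0, strictMono_id, inferInstance, by simp, fun f _ => by simp [h0]⟩
  choose p hpK hp using
    fun n => exists_probabilityMeasure_smul_eq (ν n) hK.measurableSet hne (hνK n)
  -- Prokhorov: carrying no mass outside `K` is tightness with the constant bound `0`.
  have hcomp : IsCompact {q : ProbabilityMeasure E | ∀ _ : ℕ, q Kᶜ ≤ (0 : ℝ≥0)} :=
    isCompact_setOfPred_probabilityMeasure_mass_eq_compl_isCompact_le
      (u := fun _ => 0) (K := fun _ => K) tendsto_const_nhds (fun _ => hK) (Or.inr monotone_const)
  have hmem : ∀ n, p n ∈ {q : ProbabilityMeasure E | ∀ _ : ℕ, q Kᶜ ≤ (0 : ℝ≥0)} := by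
    intro n _
    have := hpK n
    rw [← ENNReal.coe_le_coe, ProbabilityMeasure.ennreal_coeFn_eq_coeFn_toMeasure, this]
    simp
  let := TopologicalSpace.metrizableSpaceMetric E
  obtain ⟨q, hq, s, hs, hsq⟩ := hcomp.tendsto_subseq hmem
  have hm : ∀ n, (ν (s n) Set.univ).toReal ∈ Set.Icc (0 : ℝ) C := fun n =>
    ⟨ENNReal.toReal_nonneg, by
      simpa using ENNReal.toReal_mono ENNReal.coe_ne_top (hνC (s n))⟩
  -- A second extraction makes the total masses converge; the limit measure is `M` times the limit
  -- probability `q`.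
  obtain ⟨M, hM, t, ht, htM⟩ := isCompact_Icc.tendsto_subseq hm
  have hqK : (q : Measure E) Kᶜ = 0 := by
    have := hq 0
    rw [← ENNReal.coe_le_coe, ProbabilityMeasure.ennreal_coeFn_eq_coeFn_toMeasure] at this
    simpa using this
  refine ⟨s ∘ t, ENNReal.ofReal M • (q : Measure E), hs.comp ht,
    Measure.smul_finite _ ENNReal.ofReal_ne_top, by simp [hqK], fun f hf => ?_⟩
  obtain ⟨g, hg⟩ := exists_boundedContinuousFunction_eqOn hK hf
  have hgf : ∀ {r : Measure E}, r Kᶜ = 0 → ∫ x, f x ∂r = ∫ x, g x ∂r := fun {r} hr =>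
    integral_congr_ae <| by
      filter_upwards [mem_ae_iff.2 hr] with x hx using (hg hx).symm
  have key := htM.mul
    ((ProbabilityMeasure.tendsto_iff_forall_integral_tendsto.1 hsq g).comp ht.tendsto_atTop)
  rw [integral_smul_measure, ENNReal.toReal_ofReal hM.1, hgf hqK, smul_eq_mul]
  refine key.congr fun n => ?_
  simp only [Function.comp_apply]
  conv_rhs => rw [hp (s (t n))]
  rw [integral_smul_measure, hgf (hpK _), smul_eq_mul]

end Extraction

/-! ### Conditional probabilities with prescribed support. -/

section Disintegration

variable {X Y : Type*} [MeasurableSpace X] [MeasurableSpace Y] [StandardBorelSpace Y]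

/-- Disintegration of a finite measure on `X × S` with conditional probabilities that are all
supported on `S`. -/
theorem exists_kernel_compProd_eq (ρ : Measure (X × Y)) [IsFiniteMeasure ρ] {S : Set Y}
    (hS : MeasurableSet S) (hne : S.Nonempty) (h : ∀ᵐ p ∂ρ, p.2 ∈ S) :
    ∃ κ : Kernel X Y, IsMarkovKernel κ ∧ (∀ x, κ x Sᶜ = 0) ∧ ρ.fst ⊗ₘ κ = ρ := by
  classical
  obtain ⟨y, hy⟩ := hne
  have : Nonempty Y := ⟨y⟩
  have hN : MeasurableSet {x | ρ.condKernel x Sᶜ = 0} :=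
    measurableSet_eq_fun (Kernel.measurable_coe _ hS.compl) measurable_const
  -- The conditional kernel is supported on `S` only for almost every `x`; on the exceptional null
  -- set it is replaced by a Dirac mass in `S`.
  refine ⟨Kernel.piecewise hN ρ.condKernel (Kernel.const X (Measure.dirac y)), inferInstance,
    fun x => ?_, ?_⟩
  · by_cases hx : ρ.condKernel x Sᶜ = 0
    · simp [Kernel.piecewise_apply, hx]
    · simp [Kernel.piecewise_apply, hx, Measure.dirac_apply' _ hS.compl, hy]
  · have hae : ∀ᵐ x ∂ρ.fst, ρ.condKernel x Sᶜ = 0 := by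
      rw [← ρ.disintegrate ρ.condKernel] at h
      filter_upwards [Measure.ae_ae_of_ae_compProd h] with x hx using mem_ae_iff.1 hx
    conv_rhs => rw [← ρ.disintegrate ρ.condKernel]
    refine Measure.compProd_congr ?_
    filter_upwards [hae] with x hx
    simp [Kernel.piecewise_apply, hx]

end Disintegration

/-! ### Second order Taylor estimate. -/

section Taylor

variable {V : Type*} [NormedAddCommGroup V] [NormedSpace ℝ V]

/-- Second order Taylor estimate in terms of the oscillation of the second derivative. -/
theorem abs_taylor_two_le {g : V → ℝ} {P : V} {δ ε : ℝ}
    (hg : ∀ B ∈ Metric.ball P δ, DifferentiableAt ℝ g B ∧ DifferentiableAt ℝ (fderiv ℝ g) B)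
    (hε : ∀ B ∈ Metric.ball P δ, ‖fderiv ℝ (fderiv ℝ g) B - fderiv ℝ (fderiv ℝ g) P‖ ≤ ε)
    {A : V} (hA : ‖A‖ < δ) :
    |g (P + A) - g P - fderiv ℝ g P A - 1 / 2 * fderiv ℝ (fderiv ℝ g) P A A| ≤ ε * ‖A‖ ^ 2 := by
  set L := fderiv ℝ (fderiv ℝ g) P
  have hδ : 0 < δ := (norm_nonneg A).trans_lt hA
  have hε0 : 0 ≤ ε :=
    (norm_nonneg (fderiv ℝ (fderiv ℝ g) P - L)).trans (hε P (Metric.mem_ball_self hδ))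
  have hmem : ∀ t ∈ Set.Icc (0 : ℝ) 1, P + t • A ∈ Metric.ball P δ := by
    intro t ht
    rw [mem_ball_iff_norm, add_sub_cancel_left, norm_smul, Real.norm_of_nonneg ht.1]
    exact (mul_le_of_le_one_left (norm_nonneg _) ht.2).trans_lt hA
  have hfst : ∀ t ∈ Set.Icc (0 : ℝ) 1,
      ‖fderiv ℝ g (P + t • A) - fderiv ℝ g P - t • L A‖ ≤ ε * ‖A‖ := by
    intro t ht
    have := (convex_ball P δ).norm_image_sub_le_of_norm_hasFDerivWithin_le'
      (f := fderiv ℝ g) (φ := L)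
      (fun B hB => (hg B hB).2.hasFDerivAt.hasFDerivWithinAt) hε
      (Metric.mem_ball_self hδ) (hmem t ht)
    rw [add_sub_cancel_left, map_smul] at this
    refine this.trans (mul_le_mul_of_nonneg_left ?_ hε0)
    rw [norm_smul, Real.norm_of_nonneg ht.1]
    exact mul_le_of_le_one_left (norm_nonneg _) ht.2
  -- The Taylor remainder along the segment has derivative at most `ε‖A‖²`. The mean value
  -- inequality on `[0,1]` then gives the constant `ε`; integrating the bound `tε‖A‖²` would give
  -- `ε/2`, which is not needed.
  have hderiv : ∀ t ∈ Set.Icc (0 : ℝ) 1,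
      HasDerivWithinAt
        (fun t : ℝ => g (P + t • A) - t * fderiv ℝ g P A - 1 / 2 * t ^ 2 * L A A)
        ((fderiv ℝ g (P + t • A) - fderiv ℝ g P - t • L A) A) (Set.Icc 0 1) t := by
    intro t ht
    have h1 : HasDerivAt (fun t : ℝ => P + t • A) A t := by
      simpa using ((hasDerivAt_id t).smul_const A).const_add P
    have h2 := (hg _ (hmem t ht)).1.hasFDerivAt.comp_hasDerivAt t h1
    have h3 := (h2.sub ((hasDerivAt_id t).mul_const (fderiv ℝ g P A))).sub
      ((((hasDerivAt_id t).pow 2).const_mul (1 / 2)).mul_const (L A A))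
    refine (h3.congr_deriv ?_).hasDerivWithinAt
    simp
  have := (convex_Icc (0 : ℝ) 1).norm_image_sub_le_of_norm_hasDerivWithin_le
    (C := ε * ‖A‖ * ‖A‖) hderiv
    (fun t ht => (ContinuousLinearMap.le_opNorm _ _).trans
      (mul_le_mul_of_nonneg_right (hfst t ht) (norm_nonneg _)))
    (Set.left_mem_Icc.2 zero_le_one) (Set.right_mem_Icc.2 zero_le_one)
  simp only [one_smul, zero_smul, add_zero, Real.norm_eq_abs, sub_zero, abs_one, mul_one] at this
  refine (le_of_eq ?_).trans (this.trans (le_of_eq (by ring)))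
  congr 1
  ring

end Taylor

/-! ### The energy measure and its integrals. -/

section EnergyMeasure

variable {X V : Type*} [MeasurableSpace X] [NormedAddCommGroup V] [NormedSpace ℝ V]
  [MeasurableSpace V] [BorelSpace V] [SecondCountableTopology V]

/-- The image of the measure `|G|² dτ` under `x ↦ (x, a G(x), G(x) / |G(x)|)`. -/
noncomputable def energyMeasure (τ : Measure X) (a : ℝ) (G : X → V) : Measure (X × V × V) :=
  (τ.withDensity fun x => ((‖G x‖₊ ^ 2 : ℝ≥0) : ℝ≥0∞)).map
    fun x => (x, a • G x, ‖G x‖⁻¹ • G x)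

variable {τ : Measure X} {a : ℝ} {G : X → V}

theorem aemeasurable_energyMap (hG : AEMeasurable G τ) :
    AEMeasurable (fun x => (x, a • G x, ‖G x‖⁻¹ • G x))
      (τ.withDensity fun x => ((‖G x‖₊ ^ 2 : ℝ≥0) : ℝ≥0∞)) :=
  (aemeasurable_id.prodMk ((hG.const_smul a).prodMk (hG.norm.inv.smul hG))).mono_ac
    (withDensity_absolutelyContinuous _ _)

theorem energyMeasure_univ_le (hG : AEMeasurable G τ) {C : ℝ≥0} (hC : eLpNorm G 2 τ ≤ C) :
    energyMeasure τ a G Set.univ ≤ (C ^ 2 : ℝ≥0) := by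
  rw [energyMeasure, Measure.map_apply_of_aemeasurable (aemeasurable_energyMap hG) .univ,
    Set.preimage_univ, withDensity_apply _ .univ, Measure.restrict_univ]
  have h := eLpNorm_nnreal_pow_eq_lintegral (f := G) (μ := τ) (p := 2) two_ne_zero
  simp only [NNReal.coe_ofNat, ENNReal.rpow_ofNat, ENNReal.coe_ofNat] at h
  simp only [ENNReal.coe_pow]
  exact h.symm.trans_le (pow_le_pow_left' hC 2)

/-- Points with `G x = 0` carry no energy, so the undefined direction `G/|G|` there imposes no
condition. -/
theorem energyMeasure_compl_eq_zero (hG : AEMeasurable G τ) {K : Set (X × V × V)}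
    (hK : MeasurableSet K) (h : ∀ᵐ x ∂τ, G x ≠ 0 → (x, a • G x, ‖G x‖⁻¹ • G x) ∈ K) :
    energyMeasure τ a G Kᶜ = 0 := by
  have key : ∀ᵐ p ∂(energyMeasure τ a G), p ∈ K := by
    rw [energyMeasure, ae_map_iff (aemeasurable_energyMap hG) (p := fun p => p ∈ K) hK,
      ae_withDensity_iff' (hG.nnnorm.pow_const 2).coe_nnreal_ennreal]
    filter_upwards [h] with x hx h0
    exact hx fun hG0 => h0 (by simp [hG0])
  exact mem_ae_iff.1 key

theorem integral_energyMeasure (hG : AEMeasurable G τ) {f : X × V × V → ℝ}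
    (hf : AEStronglyMeasurable f (energyMeasure τ a G)) :
    ∫ p, f p ∂(energyMeasure τ a G)
      = ∫ x, ‖G x‖ ^ 2 * f (x, a • G x, ‖G x‖⁻¹ • G x) ∂τ := by
  rw [energyMeasure, integral_map (aemeasurable_energyMap hG) hf,
    integral_withDensity_eq_integral_smul₀ (hG.nnnorm.pow_const 2)]
  simp [NNReal.smul_def]

theorem integrable_of_integrable_energyMeasure (hG : AEMeasurable G τ) {f : X × V × V → ℝ}
    (hf : Integrable f (energyMeasure τ a G)) :
    Integrable (fun x => ‖G x‖ ^ 2 * f (x, a • G x, ‖G x‖⁻¹ • G x)) τ := by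
  have h := hf
  rw [energyMeasure, integrable_map_measure hf.aestronglyMeasurable (aemeasurable_energyMap hG),
    integrable_withDensity_iff_integrable_smul₀ (hG.nnnorm.pow_const 2)] at h
  simpa [NNReal.smul_def] using h

end EnergyMeasure

/-! ### Continuity of the Taylor remainder of a Lagrangian. -/

section Lagrangian

variable {d m : ℕ}

/-- Two free points `B`, `B'` are compared because the Taylor centre `F x` moves with `x`; both are
compared with `H x₀ P`. -/
theorem exists_norm_sub_lt_of_continuousWithinAt {X V N : Type*} [TopologicalSpace X]
    [PseudoMetricSpace V] [SeminormedAddCommGroup N] (H : X → V → N) {s : Set X} {O : Set V}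
    (hO : IsOpen O) {x₀ : X} {P : V} (hP : P ∈ O)
    (hH : ContinuousWithinAt (fun q : X × V => H q.1 q.2) (s ×ˢ O) (x₀, P)) {ε : ℝ}
    (hε : 0 < ε) :
    ∃ u ∈ 𝓝[s] x₀, ∃ δ > 0, Metric.ball P δ ⊆ O ∧
      ∀ x ∈ u, ∀ B ∈ Metric.ball P δ, ∀ B' ∈ Metric.ball P δ, ‖H x B - H x B'‖ < ε := by
  have h : ∀ᶠ q in 𝓝[s ×ˢ O] (x₀, P), ‖H q.1 q.2 - H x₀ P‖ < ε / 2 := by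
    simpa only [dist_eq_norm] using Metric.continuousWithinAt_iff'.1 hH (ε / 2) (half_pos hε)
  rw [Filter.Eventually, mem_nhdsWithin_prod_iff] at h
  obtain ⟨u, hu, v, hv, huv⟩ := h
  rw [hO.nhdsWithin_eq hP] at hv
  obtain ⟨δ, hδ, hδv⟩ := Metric.mem_nhds_iff.1 (inter_mem hv (hO.mem_nhds hP))
  have hd : ∀ x ∈ u, ∀ B ∈ Metric.ball P δ, ‖H x B - H x₀ P‖ < ε / 2 :=
    fun x hx B hB => huv (show (x, B) ∈ u ×ˢ v from ⟨hx, (hδv hB).1⟩)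
  refine ⟨u, hu, δ, hδ, fun B hB => (hδv hB).2, fun x hx B hB B' hB' => ?_⟩
  rw [← sub_sub_sub_cancel_right _ _ (H x₀ P)]
  exact (norm_sub_le _ _).trans_lt (by linarith [hd x hx B hB, hd x hx B' hB'])

/-- Away from `A = 0` this is a quotient of continuous functions. At `A = 0` the Taylor estimate
bounds `U` by the oscillation of `W_FF` near `F x₀`, uniformly for `x` near `x₀`. -/
theorem continuousOn_remU {Ω : Set (Vec d)} {W : Vec d → Mat m d → ℝ} {F : Vec d → Mat m d}
    (hF : ContinuousOn F (closure Ω)) (hW : IsLagrangian Ω W F) :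
    ContinuousOn (fun q : Vec d × Mat m d => remU W F q.1 q.2) (closure Ω ×ˢ Set.univ) := by
  obtain ⟨O, hO, hFO, hdiff, hW1, hW2⟩ := hW.smooth
  have hgraph : ContinuousOn (fun x => (x, F x)) (closure Ω) := continuousOn_id.prodMk hF
  have hmaps : Set.MapsTo (fun x => (x, F x)) (closure Ω) (closure Ω ×ˢ O) :=
    fun x hx => ⟨hx, hFO x hx⟩
  have hfst : ContinuousOn (fun q : Vec d × Mat m d => q.1) (closure Ω ×ˢ Set.univ) :=
    continuousOn_fst
  have hmapsfst : Set.MapsTo (fun q : Vec d × Mat m d => q.1) (closure Ω ×ˢ Set.univ)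
      (closure Ω) := fun q hq => hq.1
  have hFq := hF.comp hfst hmapsfst
  have hD := (hW1.comp hgraph hmaps).comp hfst hmapsfst
  have hH := (hW2.comp hgraph hmaps).comp hfst hmapsfst
  have hnum : ContinuousOn (fun q : Vec d × Mat m d =>
      Wcirc W F q.1 q.2 - 1 / 2 * hessL W F q.1 q.2 q.2) (closure Ω ×ˢ Set.univ) := by
    have hWA := hW.continuousOn.comp (hfst.prodMk (hFq.add continuousOn_snd))
      fun q hq => ⟨hq.1, trivial⟩
    have hWF := hW.continuousOn.comp (hfst.prodMk hFq) fun q hq => ⟨hq.1, trivial⟩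
    exact ((hWA.sub hWF).sub (hD.clm_apply continuousOn_snd)).sub
      (continuousOn_const.mul ((hH.clm_apply continuousOn_snd).clm_apply continuousOn_snd))
  rintro ⟨x₀, A₀⟩ ⟨hx₀, -⟩
  by_cases hA₀ : A₀ = 0
  · subst hA₀
    rw [Metric.continuousWithinAt_iff']
    intro ε hε
    obtain ⟨u, hu, δ, hδ, hδO, hδu⟩ := exists_norm_sub_lt_of_continuousWithinAt (N := Tensor4 m d)
      (fun x B => fderiv ℝ (fderiv ℝ (W x)) B) hO (hFO x₀ hx₀) (hW2 (x₀, F x₀) (hmaps hx₀))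
      (half_pos hε)
    -- With `F x` within `δ/2` of `F x₀`, the ball of radius `δ/2` about `F x` stays where the
    -- oscillation is controlled.
    have hx : ∀ᶠ x in 𝓝[closure Ω] x₀, x ∈ u ∧ x ∈ closure Ω ∧ F x ∈ Metric.ball (F x₀) (δ / 2) :=
      (show ∀ᶠ x in 𝓝[closure Ω] x₀, x ∈ u from hu).and
        ((show ∀ᶠ x in 𝓝[closure Ω] x₀, x ∈ closure Ω from self_mem_nhdsWithin).and
          (hF x₀ hx₀ (Metric.ball_mem_nhds _ (half_pos hδ))))
    have hA : ∀ᶠ A : Mat m d in 𝓝[Set.univ] 0, ‖A‖ < δ / 2 := by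
      rw [nhdsWithin_univ]
      filter_upwards [Metric.ball_mem_nhds (0 : Mat m d) (half_pos hδ)] with A hA
        using mem_ball_zero_iff.1 hA
    rw [nhdsWithin_prod_eq]
    filter_upwards [hx.prod_mk hA] with ⟨x, A⟩ ⟨⟨hxu, hxΩ, hxF⟩, hA⟩
    have hball : Metric.ball (F x) (δ / 2) ⊆ Metric.ball (F x₀) δ := by
      refine Metric.ball_subset_ball' ?_
      rw [Metric.mem_ball] at hxF
      linarith
    have htaylor := abs_taylor_two_le (g := W x) (P := F x) (δ := δ / 2) (ε := ε / 2)
      (fun B hB => hdiff x hxΩ B (hδO (hball hB)))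
      (fun B hB => (hδu x hxu B (hball hB) (F x)
        (hball (Metric.mem_ball_self (half_pos hδ)))).le) hA
    have h0 : remU W F x₀ 0 = 0 := by simp [remU]
    rw [h0, Real.dist_eq, sub_zero]
    by_cases hA0 : A = 0
    · simpa [remU, hA0] using hε
    have hpos : 0 < ‖A‖ ^ 2 := pow_pos (norm_pos_iff.2 hA0) 2
    rw [remU, abs_div, abs_of_pos hpos, div_lt_iff₀ hpos]
    exact htaylor.trans_lt (mul_lt_mul_of_pos_right (half_lt_self hε) hpos)
  · exact (hnum _ ⟨hx₀, trivial⟩).div (continuous_snd.norm.pow 2).continuousWithinAt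
      (pow_ne_zero 2 (norm_ne_zero_iff.2 hA₀))

theorem continuousOn_hessL {Ω : Set (Vec d)} {W : Vec d → Mat m d → ℝ} {F : Vec d → Mat m d}
    (hF : ContinuousOn F (closure Ω)) (hW : IsLagrangian Ω W F) :
    ContinuousOn (hessL W F) (closure Ω) := by
  obtain ⟨O, -, hFO, -, -, hW2⟩ := hW.smooth
  exact hW2.comp (continuousOn_id.prodMk hF) fun x hx => ⟨hx, hFO x hx⟩

theorem calF_eq (W : Vec d → Mat m d → ℝ) (F : Vec d → Mat m d) (x : Vec d) {α : ℝ}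
    (hα : α ≠ 0) (G : Mat m d) :
    calF W F x α G = remU W F x (α • G) * ‖G‖ ^ 2 + 1 / 2 * hessL W F x G G := by
  by_cases hG : G = 0
  · simp [calF, Wcirc, hG]
  have hG' : ‖G‖ ≠ 0 := norm_ne_zero_iff.2 hG
  simp only [calF, remU, norm_smul, map_smul, smul_apply, smul_eq_mul,
    mul_pow, Real.norm_eq_abs, sq_abs]
  field_simp
  ring

end Lagrangian

/-! ### Passing to the limit and disintegrating it. -/

section Representation

theorem fst_compl_eq_zero {X Y : Type*} [MeasurableSpace X] [MeasurableSpace Y]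
    {ρ : Measure (X × Y)} {S : Set X} (hS : MeasurableSet S) {T : Set Y}
    (h : ρ (S ×ˢ T)ᶜ = 0) : ρ.fst Sᶜ = 0 := by
  rw [Measure.fst_apply hS.compl]
  refine measure_mono_null (t := (S ×ˢ T)ᶜ) ?_ h
  exact fun p hp hp' => hp hp'.1

variable {d m : ℕ}

theorem calI_eq {R : ℝ} {μ lam : Kernel (Vec d) (Mat m d)}
    (hμ : ∀ x, μ x (Metric.closedBall 0 R)ᶜ = 0) (hlam : ∀ x, lam x (Metric.sphere 0 1)ᶜ = 0)
    (U : Vec d → Mat m d → ℝ) (L : Vec d → Tensor4 m d) (x : Vec d) :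
    calI R U L μ lam x = ∫ A, U x A ∂(μ x) + 1 / 2 * ∫ A, L x A A ∂(lam x) := by
  rw [calI, restrict_eq_self_of_compl_null (hμ x), restrict_eq_self_of_compl_null (hlam x)]

/-- The kernels obtained by disintegrating the two marginals of `ρ`. -/
theorem exists_kernels {X Y Z : Type*} [MeasurableSpace X] [MeasurableSpace Y]
    [StandardBorelSpace Y] [MeasurableSpace Z] [StandardBorelSpace Z] (ρ : Measure (X × Y × Z))
    [IsFiniteMeasure ρ] {S : Set Y} {T : Set Z} (hS : MeasurableSet S) (hT : MeasurableSet T)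
    (hSne : S.Nonempty) (hTne : T.Nonempty) (h : ∀ᵐ p ∂ρ, p.2 ∈ S ×ˢ T) :
    ∃ (μ : Kernel X Y) (κ : Kernel X Z), IsMarkovKernel μ ∧ (∀ x, μ x Sᶜ = 0) ∧
      IsMarkovKernel κ ∧ (∀ x, κ x Tᶜ = 0) ∧
      ρ.fst ⊗ₘ μ = ρ.map (fun p => (p.1, p.2.1)) ∧ ρ.fst ⊗ₘ κ = ρ.map (fun p => (p.1, p.2.2)) := by
  have h1 : Measurable fun p : X × Y × Z => (p.1, p.2.1) := by fun_prop
  have h2 : Measurable fun p : X × Y × Z => (p.1, p.2.2) := by fun_prop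
  obtain ⟨μ, hμ, hμS, hμρ⟩ := exists_kernel_compProd_eq (ρ.map fun p => (p.1, p.2.1)) hS hSne
    ((ae_map_iff h1.aemeasurable (p := fun p : X × Y => p.2 ∈ S) (measurable_snd hS)).2
      (h.mono fun p hp => hp.1))
  obtain ⟨κ, hκ, hκT, hκρ⟩ := exists_kernel_compProd_eq (ρ.map fun p => (p.1, p.2.2)) hT hTne
    ((ae_map_iff h2.aemeasurable (p := fun p : X × Z => p.2 ∈ T) (measurable_snd hT)).2
      (h.mono fun p hp => hp.2))
  refine ⟨μ, κ, hμ, hμS, hκ, hκT, ?_, ?_⟩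
  · rwa [Measure.fst_map_prodMk (by fun_prop)] at hμρ
  · rwa [Measure.fst_map_prodMk (by fun_prop)] at hκρ

theorem integrable_integral_and_integral_eq {X Y E : Type*} [MeasurableSpace X]
    [MeasurableSpace Y] [MeasurableSpace E] {π : Measure X} [SFinite π] {κ : Kernel X Y}
    [IsSFiniteKernel κ] {ρ : Measure E} {φ : E → X × Y} (hφ : Measurable φ)
    (h : π ⊗ₘ κ = ρ.map φ) {f : X → Y → ℝ}
    (hm : AEStronglyMeasurable (fun p : X × Y => f p.1 p.2) (ρ.map φ))
    (hf : Integrable (fun p => f (φ p).1 (φ p).2) ρ) :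
    Integrable (fun x => ∫ y, f x y ∂(κ x)) π ∧
      ∫ x, ∫ y, f x y ∂(κ x) ∂π = ∫ p, f (φ p).1 (φ p).2 ∂ρ := by
  have hi : Integrable (fun p : X × Y => f p.1 p.2) (π ⊗ₘ κ) := by
    rw [h]
    exact (integrable_map_measure hm hφ.aemeasurable).2 hf
  refine ⟨?_, ?_⟩
  -- The measure `π` is viewed as a constant kernel over a one-point space.
  · have := Integrable.integral_compProd (κ := Kernel.const Unit π)
      (η := Kernel.prodMkLeft Unit κ) (a := ()) hi
    simpa using this
  · rw [← Measure.integral_compProd hi, h, integral_map hφ.aemeasurable hm]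

/-- The limit formula: integration against `ρ` is integration of `calI` against its first
marginal. -/
theorem calI_integrable_and_integral_eq {Ω : Set (Vec d)} (hΩ : IsCompact (closure Ω)) {R : ℝ}
    {ρ : Measure (Vec d × Mat m d × Mat m d)} [IsFiniteMeasure ρ]
    (hρ : ρ (closure Ω ×ˢ (Metric.closedBall 0 R ×ˢ Metric.sphere 0 1))ᶜ = 0)
    {μ lam : Kernel (Vec d) (Mat m d)} [IsMarkovKernel μ] [IsMarkovKernel lam]
    (hμ : ∀ x, μ x (Metric.closedBall 0 R)ᶜ = 0) (hlam : ∀ x, lam x (Metric.sphere 0 1)ᶜ = 0)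
    (hμρ : ρ.fst ⊗ₘ μ = ρ.map fun p => (p.1, p.2.1))
    (hlamρ : ρ.fst ⊗ₘ lam = ρ.map fun p => (p.1, p.2.2))
    {U : Vec d → Mat m d → ℝ} {L : Vec d → Tensor4 m d}
    (hU : ContinuousOn (fun q : Vec d × Mat m d => U q.1 q.2) (closure Ω ×ˢ Set.univ))
    (hL : ContinuousOn L (closure Ω)) :
    Integrable (calI R U L μ lam) ρ.fst ∧
      ∫ x, calI R U L μ lam x ∂ρ.fst
        = ∫ p, (U p.1 p.2.1 + 1 / 2 * L p.1 p.2.2 p.2.2) ∂ρ := by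
  have hK : IsCompact (closure Ω ×ˢ (Metric.closedBall (0 : Mat m d) R ×ˢ
    Metric.sphere (0 : Mat m d) 1)) :=
    hΩ.prod ((isCompact_closedBall _ _).prod (isCompact_sphere _ _))
  have h1 : Measurable fun p : Vec d × Mat m d × Mat m d => (p.1, p.2.1) := by fun_prop
  have h2 : Measurable fun p : Vec d × Mat m d × Mat m d => (p.1, p.2.2) := by fun_prop
  have hae : ∀ᵐ p ∂ρ, p.1 ∈ closure Ω := by
    filter_upwards [mem_ae_iff.2 hρ] with p hp using hp.1
  have hmeas : MeasurableSet (closure Ω ×ˢ (Set.univ : Set (Mat m d))) :=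
    isClosed_closure.measurableSet.prod .univ
  have hLq : ContinuousOn (fun q : Vec d × Mat m d => L q.1 q.2 q.2) (closure Ω ×ˢ Set.univ) :=
    ((hL.comp continuousOn_fst fun q hq => hq.1).clm_apply continuousOn_snd).clm_apply
      continuousOn_snd
  have hsm : ∀ {φ : Vec d × Mat m d × Mat m d → Vec d × Mat m d}, Measurable φ →
      (∀ p, (φ p).1 = p.1) → ∀ {f : Vec d × Mat m d → ℝ},
      ContinuousOn f (closure Ω ×ˢ Set.univ) → AEStronglyMeasurable f (ρ.map φ) := by
    intro φ hφ hφ1 f hf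
    -- `f` is controlled only over `Ω̄`, but the image measure is concentrated there.
    rw [← restrict_eq_self_of_compl_null (ν := ρ.map φ) (K := closure Ω ×ˢ Set.univ)]
    · exact hf.aestronglyMeasurable hmeas
    · refine mem_ae_iff.1 ((ae_map_iff hφ.aemeasurable
        (p := fun q => q ∈ closure Ω ×ˢ Set.univ) hmeas).2 ?_)
      filter_upwards [hae] with p hp using ⟨by rwa [hφ1], trivial⟩
  have hi1 : Integrable (fun p : Vec d × Mat m d × Mat m d => U p.1 p.2.1) ρ :=
    integrable_of_continuousOn_of_compl_null hK hρ
      (hU.comp (f := fun p : Vec d × Mat m d × Mat m d => (p.1, p.2.1)) (by fun_prop)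
        fun p hp => ⟨hp.1, trivial⟩)
  have hi2 : Integrable (fun p : Vec d × Mat m d × Mat m d => L p.1 p.2.2 p.2.2) ρ :=
    integrable_of_continuousOn_of_compl_null hK hρ
      (hLq.comp (f := fun p : Vec d × Mat m d × Mat m d => (p.1, p.2.2)) (by fun_prop)
        fun p hp => ⟨hp.1, trivial⟩)
  obtain ⟨hj1, he1⟩ := integrable_integral_and_integral_eq h1 hμρ (f := U)
    (hsm h1 (fun _ => rfl) hU) hi1
  obtain ⟨hj2, he2⟩ := integrable_integral_and_integral_eq h2 hlamρ (f := fun x A => L x A A)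
    (hsm h2 (fun _ => rfl) hLq) hi2
  rw [show calI R U L μ lam = fun x => _ from funext (calI_eq hμ hlam U L)]
  refine ⟨hj1.add (hj2.const_mul _), ?_⟩
  rw [integral_add hj1 (hj2.const_mul _), integral_add hi1 (hi2.const_mul _),
    integral_const_mul, integral_const_mul, he1, he2]

/-- Multiplying the integrand by a function of `x` alone. -/
theorem calI_mul (R : ℝ) (U : Vec d → Mat m d → ℝ) (L : Vec d → Tensor4 m d)
    (μ lam : Kernel (Vec d) (Mat m d)) (ξ : Vec d → ℝ) (x : Vec d) :
    calI R (fun x A => ξ x * U x A) (fun x => ξ x • L x) μ lam x = ξ x * calI R U L μ lam x := by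
  simp only [calI, smul_apply, smul_eq_mul, integral_const_mul]
  ring

/-- Quadratic homogeneity cancels `|G|²` against the normalization; at `G = 0` both sides vanish. -/
theorem energy_integrand_eq {X : Type*} (U : X → Mat m d → ℝ) (L : X → Tensor4 m d) (x : X) (a : ℝ)
    (G : Mat m d) :
    ‖G‖ ^ 2 * (U x (a • G) + 1 / 2 * L x (‖G‖⁻¹ • G) (‖G‖⁻¹ • G))
      = U x (a • G) * ‖G‖ ^ 2 + 1 / 2 * L x G G := by
  by_cases hG : G = 0
  · simp [hG]
  have hG' : ‖G‖ ≠ 0 := norm_ne_zero_iff.2 hG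
  simp only [map_smul, smul_apply, smul_eq_mul]
  field_simp

theorem weakStarTendsto_of_energyMeasure {Ω : Set (Vec d)} (hΩ : IsCompact (closure Ω)) {R : ℝ}
    {ρ : Measure (Vec d × Mat m d × Mat m d)} [IsFiniteMeasure ρ]
    (hρ : ρ (closure Ω ×ˢ (Metric.closedBall 0 R ×ˢ Metric.sphere 0 1))ᶜ = 0)
    {μ lam : Kernel (Vec d) (Mat m d)} [IsMarkovKernel μ] [IsMarkovKernel lam]
    (hμ : ∀ x, μ x (Metric.closedBall 0 R)ᶜ = 0) (hlam : ∀ x, lam x (Metric.sphere 0 1)ᶜ = 0)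
    (hμρ : ρ.fst ⊗ₘ μ = ρ.map fun p => (p.1, p.2.1))
    (hlamρ : ρ.fst ⊗ₘ lam = ρ.map fun p => (p.1, p.2.2))
    {a : ℕ → ℝ} {G : ℕ → Vec d → Mat m d} (hG : ∀ n, AEMeasurable (G n) (volume.restrict Ω))
    [∀ n, IsFiniteMeasure (energyMeasure (volume.restrict Ω) (a n) (G n))]
    (hGK : ∀ n, energyMeasure (volume.restrict Ω) (a n) (G n)
      (closure Ω ×ˢ (Metric.closedBall 0 R ×ˢ Metric.sphere 0 1))ᶜ = 0)
    (hlim : ∀ f : Vec d × Mat m d × Mat m d → ℝ,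
      ContinuousOn f (closure Ω ×ˢ (Metric.closedBall 0 R ×ˢ Metric.sphere 0 1)) →
      Tendsto (fun n => ∫ p, f p ∂(energyMeasure (volume.restrict Ω) (a n) (G n))) atTop
        (𝓝 (∫ p, f p ∂ρ)))
    {U : Vec d → Mat m d → ℝ} {L : Vec d → Tensor4 m d}
    (hU : ContinuousOn (fun q : Vec d × Mat m d => U q.1 q.2) (closure Ω ×ˢ Set.univ))
    (hL : ContinuousOn L (closure Ω)) :
    WeakStarTendsto Ω
      (fun n x => U x (a n • G n x) * ‖G n x‖ ^ 2 + 1 / 2 * L x (G n x) (G n x))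
      (calI R U L μ lam) ρ.fst := by
  have hK : IsCompact (closure Ω ×ˢ (Metric.closedBall (0 : Mat m d) R ×ˢ
    Metric.sphere (0 : Mat m d) 1)) :=
    hΩ.prod ((isCompact_closedBall _ _).prod (isCompact_sphere _ _))
  have hcont : ∀ {U : Vec d → Mat m d → ℝ} {L : Vec d → Tensor4 m d},
      ContinuousOn (fun q : Vec d × Mat m d => U q.1 q.2) (closure Ω ×ˢ Set.univ) →
      ContinuousOn L (closure Ω) →
      ContinuousOn (fun p : Vec d × Mat m d × Mat m d => U p.1 p.2.1 + 1 / 2 * L p.1 p.2.2 p.2.2)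
        (closure Ω ×ˢ (Metric.closedBall 0 R ×ˢ Metric.sphere 0 1)) := by
    intro U L hU hL
    have h2 : ContinuousOn (fun p : Vec d × Mat m d × Mat m d => p.2.2)
      (closure Ω ×ˢ (Metric.closedBall 0 R ×ˢ Metric.sphere 0 1)) := by fun_prop
    exact (hU.comp (f := fun p : Vec d × Mat m d × Mat m d => (p.1, p.2.1)) (by fun_prop)
        fun p hp => ⟨hp.1, trivial⟩).add
      (continuousOn_const.mul (((hL.comp continuousOn_fst fun p hp => hp.1).clm_apply
        h2).clm_apply h2))
  have hint : ∀ n {U : Vec d → Mat m d → ℝ} {L : Vec d → Tensor4 m d},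
      ContinuousOn (fun q : Vec d × Mat m d => U q.1 q.2) (closure Ω ×ˢ Set.univ) →
      ContinuousOn L (closure Ω) →
      Integrable (fun p : Vec d × Mat m d × Mat m d => U p.1 p.2.1 + 1 / 2 * L p.1 p.2.2 p.2.2)
        (energyMeasure (volume.restrict Ω) (a n) (G n)) := fun n {U L} hU hL =>
    integrable_of_continuousOn_of_compl_null hK (hGK n) (hcont hU hL)
  refine ⟨fun n => ?_, ?_, fun ξ hξ => ?_⟩
  · refine (integrable_of_integrable_energyMeasure (hG n) (hint n hU hL)).congr (ae_of_all _ ?_)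
    exact fun x => energy_integrand_eq U L x (a n) (G n x)
  · exact (calI_integrable_and_integral_eq hΩ hρ hμ hlam hμρ hlamρ hU hL).1.integrableOn
  · have hξU : ContinuousOn (fun q : Vec d × Mat m d => ξ q.1 * U q.1 q.2)
        (closure Ω ×ˢ Set.univ) := (hξ.comp continuousOn_fst fun q hq => hq.1).mul hU
    have hξL : ContinuousOn (fun x => ξ x • L x) (closure Ω) := hξ.smul hL
    have hfst : ρ.fst (closure Ω)ᶜ = 0 :=
      fst_compl_eq_zero isClosed_closure.measurableSet hρ
    -- The test function is absorbed into the pair: `(ξU, ξL)` is again admissible.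
    have key := hlim _ (hcont (U := fun x A => ξ x * U x A) hξU hξL)
    rw [← (calI_integrable_and_integral_eq hΩ hρ hμ hlam hμρ hlamρ
      (U := fun x A => ξ x * U x A) hξU hξL).2] at key
    simp only [calI_mul] at key
    rw [restrict_eq_self_of_compl_null hfst]
    refine key.congr fun n => ?_
    rw [integral_energyMeasure (hG n)
      (hint n (U := fun x A => ξ x * U x A) hξU hξL).aestronglyMeasurable]
    refine integral_congr_ae (ae_of_all _ fun x => ?_)
    refine (energy_integrand_eq (fun x A => ξ x * U x A) (fun x => ξ x • L x) x (a n)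
      (G n x)).trans ?_
    simp only [smul_apply, smul_eq_mul]
    ring

end Representation

end StrongLocalMin

/-! ### The representation theorem. -/

open StrongLocalMin in
theorem theorem5p1 {d m : ℕ} (hd : 0 < d) (hm : 0 < m)
    (Ω : Set (StrongLocalMin.Vec d)) (hΩo : IsOpen Ω) (hΩb : Bornology.IsBounded Ω)
    (ψ : ℕ → StrongLocalMin.Vec d → StrongLocalMin.Vec m)
    (Dψ : ℕ → StrongLocalMin.Vec d → StrongLocalMin.Mat m d)
    (hψ : StrongLocalMin.BoundedInW1 Ω 2 ψ Dψ)
    (α : ℕ → ℝ) (hα : ∀ n, 0 < α n)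
    (hφ : StrongLocalMin.BoundedInW1 Ω ⊤ (fun n x => α n • ψ n x) (fun n x => α n • Dψ n x))
    (R : ℝ) (hR0 : 0 ≤ R)
    (hR : ∀ n, eLpNorm (fun x => α n • Dψ n x) ⊤ (volume.restrict Ω) ≤ ENNReal.ofReal R) :
    ∃ (s : ℕ → ℕ) (π : Measure (StrongLocalMin.Vec d))
      (μ lam : Kernel (StrongLocalMin.Vec d) (StrongLocalMin.Mat m d)),
      StrictMono s ∧ IsFiniteMeasure π ∧ π (closure Ω)ᶜ = 0 ∧
      IsMarkovKernel μ ∧ (∀ x ∈ closure Ω, μ x (Metric.closedBall 0 R)ᶜ = 0) ∧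
      IsMarkovKernel lam ∧ (∀ x ∈ closure Ω, lam x (Metric.sphere 0 1)ᶜ = 0) ∧
      -- the representation formula, for every Lagrangian and every `C¹` map `y`
      (∀ (W : StrongLocalMin.Vec d → StrongLocalMin.Mat m d → ℝ)
        (y : StrongLocalMin.Vec d → StrongLocalMin.Vec m)
        (F : StrongLocalMin.Vec d → StrongLocalMin.Mat m d),
        StrongLocalMin.IsC1UpToBoundary Ω y F → StrongLocalMin.IsLagrangian Ω W F →
        StrongLocalMin.WeakStarTendsto Ω
          (fun n x => StrongLocalMin.calF W F x (α (s n)) (Dψ (s n) x))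
          (StrongLocalMin.calI R (StrongLocalMin.remU W F) (StrongLocalMin.hessL W F) μ lam) π) ∧
      -- the same formula for arbitrary continuous pairs `(U, L)`
      (∀ (U : StrongLocalMin.Vec d → StrongLocalMin.Mat m d → ℝ)
        (L : StrongLocalMin.Vec d → StrongLocalMin.Tensor4 m d),
        ContinuousOn (fun q : StrongLocalMin.Vec d × StrongLocalMin.Mat m d => U q.1 q.2)
          (closure Ω ×ˢ Set.univ) →
        ContinuousOn L (closure Ω) →
        StrongLocalMin.WeakStarTendsto Ω
          (fun n x => U x (α (s n) • Dψ (s n) x) * ‖Dψ (s n) x‖ ^ 2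
            + 1 / 2 * L x (Dψ (s n) x) (Dψ (s n) x))
          (StrongLocalMin.calI R U L μ lam) π) ∧
      StrongLocalMin.WeakStarTendsto Ω (fun n x => ‖Dψ (s n) x‖ ^ 2) (fun _ => 1) π := by
  -- Positive dimensions make the matrix space nontrivial, so the unit sphere is nonempty and can
  -- carry probability measures.
  have : Nonempty (Fin m × Fin d) := ⟨⟨⟨0, hm⟩, ⟨0, hd⟩⟩⟩
  obtain ⟨C, hC⟩ := hψ
  have hΩ : IsCompact (closure Ω) := hΩb.isCompact_closure
  have hG : ∀ n, AEMeasurable (Dψ n) (volume.restrict Ω) := fun n =>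
    (hC n).1.memLp_grad.aestronglyMeasurable.aemeasurable
  have hball : (Metric.closedBall (0 : Mat m d) R).Nonempty := ⟨0, Metric.mem_closedBall_self hR0⟩
  have hsphere : (Metric.sphere (0 : Mat m d) 1).Nonempty :=
    NormedSpace.sphere_nonempty.2 zero_le_one
  have hK : IsCompact (closure Ω ×ˢ (Metric.closedBall (0 : Mat m d) R ×ˢ
    Metric.sphere (0 : Mat m d) 1)) :=
    hΩ.prod ((isCompact_closedBall _ _).prod (isCompact_sphere _ _))
  have hmass : ∀ n, energyMeasure (volume.restrict Ω) (α n) (Dψ n) Set.univ ≤ (C ^ 2 : ℝ≥0) :=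
    fun n => energyMeasure_univ_le (hG n) (hC n).2.2
  have hfin : ∀ n, IsFiniteMeasure (energyMeasure (volume.restrict Ω) (α n) (Dψ n)) :=
    fun n => ⟨(hmass n).trans_lt ENNReal.coe_lt_top⟩
  have hGK : ∀ n, energyMeasure (volume.restrict Ω) (α n) (Dψ n)
      (closure Ω ×ˢ (Metric.closedBall 0 R ×ˢ Metric.sphere 0 1))ᶜ = 0 := by
    refine fun n => energyMeasure_compl_eq_zero (hG n) hK.measurableSet ?_
    have hle : ∀ᵐ x ∂(volume.restrict Ω), ‖α n • Dψ n x‖ₑ ≤ ENNReal.ofReal R := by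
      have := hR n
      rw [eLpNorm_exponent_top] at this
      filter_upwards [enorm_ae_le_eLpNormEssSup (fun x => α n • Dψ n x) (volume.restrict Ω)]
        with x hx using hx.trans this
    filter_upwards [hle, ae_restrict_mem hΩo.measurableSet] with x hx hxΩ h0
    refine ⟨subset_closure hxΩ, ?_, ?_⟩
    · rw [← ofReal_norm, ENNReal.ofReal_le_ofReal_iff hR0] at hx
      simpa using hx
    · rw [mem_sphere_zero_iff_norm, norm_smul, norm_inv, norm_norm]
      exact inv_mul_cancel₀ (norm_ne_zero_iff.2 h0)
  obtain ⟨s, ρ, hs, hρfin, hρ, hlim⟩ := exists_subseq_tendsto_integral hK _ hGK hmass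
  obtain ⟨μ, lam, hμM, hμ, hlamM, hlam, hμρ, hlamρ⟩ := exists_kernels ρ
    Metric.isClosed_closedBall.measurableSet Metric.isClosed_sphere.measurableSet hball hsphere
    (by filter_upwards [mem_ae_iff.2 hρ] with p hp using hp.2)
  have hfst : ρ.fst (closure Ω)ᶜ = 0 :=
    fst_compl_eq_zero isClosed_closure.measurableSet hρ
  have hrep : ∀ (U : Vec d → Mat m d → ℝ) (L : Vec d → Tensor4 m d),
      ContinuousOn (fun q : Vec d × Mat m d => U q.1 q.2) (closure Ω ×ˢ Set.univ) →
      ContinuousOn L (closure Ω) → WeakStarTendsto Ω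
        (fun n x => U x (α (s n) • Dψ (s n) x) * ‖Dψ (s n) x‖ ^ 2
          + 1 / 2 * L x (Dψ (s n) x) (Dψ (s n) x)) (calI R U L μ lam) ρ.fst :=
    fun U L hU hL => weakStarTendsto_of_energyMeasure hΩ hρ hμ hlam hμρ hlamρ
      (fun n => hG (s n)) (fun n => hGK (s n)) hlim hU hL
  refine ⟨s, ρ.fst, μ, lam, hs, inferInstance, hfst, hμM, fun x _ => hμ x, hlamM,
    fun x _ => hlam x, fun W y F hy hW => ?_, hrep, ?_⟩
  · simp only [calF_eq W F _ (hα _).ne']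
    exact hrep _ _ (continuousOn_remU hy.continuousOn_grad hW)
      (continuousOn_hessL hy.continuousOn_grad hW)
  · have h := hrep (fun _ _ => 1) (fun _ => 0) continuousOn_const continuousOn_const
    -- With `U = 1` and `L = 0` the density is the mass of the probability measure `μ_x`.
    have hone : calI R (fun _ _ => 1) (fun _ => 0) μ lam = fun _ => 1 := by
      ext x
      rw [calI_eq hμ hlam]
      simp
    simpa [hone] using h
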